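/- **Conventions.** A Hermitian symmetric space of complex dimension $n$ is a connected complex manifold $M$ of dimension $n$ with complex structure $J$ and a $C^\infty$ Hermitian metric (a Riemannian metric $g$ with $g(Jv,Jw)=g(v,w)$) such that every $p\in M$ is an isolated fixed point of an involutive holomorphic isometry of $M$. It is irreducible if $n>0$ and, at each point, the real linear isotropy representation of the group of transvections (the group generated by the products of two symmetries of $M$) is irreducible. A real form of $M$ is a non-empty set of the form $B=\{p\in M:\sigma(p)=p\}$, where $\sigma$ is an involutive anti-holomorphic isometry of $M$, said to be associated with $B$. Let $M$ be either $\mathbb C^n$ with its flat metric or an irreducible Hermitian symmetric space of complex dimension $n$, up to holomorphic isometry. A real form $B$ of $M$ is called recursive if there is a chain $\tilde M_1\subset\tilde M_2\subset\dots\subset\tilde M_{n-1}\subset M$ of Hermitian symmetric spaces of the same type as $M$ (Euclidean, compact, or non-compact non-Euclidean) such that 1. $\dim_{\mathbb C}\tilde M_k=k$ for $1\le k\le n-1$; 2. $\tilde M_{n-1}$ is a totally geodesic submanifold of $M$, and $\tilde M_k$ is a totally geodesic submanifold of $\tilde M_{k+1}$ for $1\le k<n-1$; 3. each $\tilde M_k$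 is an embedded complex submanifold of $M$ and carries the complex structure and the metric induced from $M$; 4. $B\cap\tilde M_k$ is a real form of $\tilde M_k$ for $1\le k\le n-1$, and for $2\le l\le n-1$ there is a set $H_l\subset\tilde M_l$ that contains $(B\cap\tilde M_l)\cup\tilde M_{l-1}$ and that is a smooth real hypersurface of $\tilde M_l$ in a neighbourhood of each point of a dense subset of $(B\cap\tilde M_l)\cup\tilde M_{l-1}$. **Corollary 6.3.** Let $M$ be a Hermitian symmetric space of complex dimension $n$, let $B$ be a recursive real form of $M$, and let $\sigma$ be an involutive anti-holomorphic isometry of $M$ whose fixed point set is $B$. Let $f:M\to\mathbb C$ be a holomorphic function that takes real values on $B$. Then $$f(\sigma(p))=\overline{f(p)}\qquad\text{for all }p\in M.$$ -/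

import Mathlib

open scoped Manifold ContDiff Topology ComplexConjugate

universe u

/-- The standard `n`-dimensional complex vector space, used as the model of complex manifolds. -/
abbrev Cn (n : ℕ) : Type := EuclideanSpace ℂ (Fin n)

/-- A complex manifold is a real analytic (in particular smooth) manifold, with the same charts. -/
instance isManifold_real_of_complex {n : ℕ} {M : Type*} [TopologicalSpace M]
    [ChartedSpace (Cn n) M] [IsManifold 𝓘(ℂ, Cn n) ω M] : IsManifold 𝓘(ℝ, Cn n) ω M := by
  refine isManifold_of_contDiffOn _ _ _ fun e e' he he' => ?_
  have h : e.symm ≫ₕ e' ∈ contDiffGroupoid ω 𝓘(ℂ, Cn n) :=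
    (contDiffGroupoid ω 𝓘(ℂ, Cn n)).compatible he he'
  rw [contDiffGroupoid, mem_groupoid_of_pregroupoid] at h
  have h' : ContDiffOn ℂ ω _ _ := h.1
  exact h'.restrict_scalars ℝ

/-- The real tangent space at a point of a complex manifold. -/
abbrev RealTangent (n : ℕ) {M : Type*} [TopologicalSpace M] [ChartedSpace (Cn n) M] (p : M) :
    Type :=
  TangentSpace 𝓘(ℝ, Cn n) p

/-- The almost complex structure `J` on the real tangent spaces of a complex manifold:
multiplication by `i` in a holomorphic chart. -/
noncomputable def complexJ (n : ℕ) {M : Type*} [TopologicalSpace M] [ChartedSpace (Cn n) M]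
    (p : M) : RealTangent n p →L[ℝ] RealTangent n p :=
  (Complex.I • ContinuousLinearMap.id ℝ (Cn n) : Cn n →L[ℝ] Cn n)

/-- A Hermitian manifold of complex dimension `n`: a complex manifold (Hausdorff and second
countable, charts in `ℂⁿ` with holomorphic transition maps) with a `C^∞` Riemannian metric for
which the complex structure `J` is orthogonal. -/
structure HermitianManifold (n : ℕ) where
  carrier : Type u
  [top : TopologicalSpace carrier]
  [t2 : T2Space carrier]
  [sct : SecondCountableTopology carrier]
  [charted : ChartedSpace (Cn n) carrier]
  [complexMfd : IsManifold 𝓘(ℂ, Cn n) ω carrier]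
  /-- the Riemannian metric -/
  metric : Bundle.ContMDiffRiemannianMetric 𝓘(ℝ, Cn n) ∞ (Cn n)
    (fun p : carrier => RealTangent n p)
  metric_J : ∀ (p : carrier) (v w : RealTangent n p),
    metric.inner p (complexJ n p v) (complexJ n p w) = metric.inner p v w

namespace HermitianManifold

instance (n : ℕ) : CoeSort (HermitianManifold.{u} n) (Type u) := ⟨carrier⟩

attribute [instance] top t2 sct charted complexMfd

variable {m n : ℕ}

/-- The differential of a map between complex manifolds, as a real linear map. -/
noncomputable def differential (M : HermitianManifold.{u} m) (N : HermitianManifold.{u} n)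
    (F : M → N) (p : M) : RealTangent m p →L[ℝ] RealTangent n (F p) :=
  mfderiv 𝓘(ℝ, Cn m) 𝓘(ℝ, Cn n) F p

/-- `F` is holomorphic. -/
def IsHolomorphic (M : HermitianManifold.{u} m) (N : HermitianManifold.{u} n) (F : M → N) :
    Prop :=
  MDifferentiable 𝓘(ℂ, Cn m) 𝓘(ℂ, Cn n) F

/-- `F` is anti-holomorphic: it is smooth and `dF ∘ J = - J ∘ dF`. -/
def IsAntiholomorphic (M : HermitianManifold.{u} m) (N : HermitianManifold.{u} n) (F : M → N) :
    Prop :=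
  ContMDiff 𝓘(ℝ, Cn m) 𝓘(ℝ, Cn n) ∞ F ∧
    ∀ (p : M) (v : RealTangent m p),
      differential M N F p (complexJ m p v) = -complexJ n (F p) (differential M N F p v)

/-- `F` pulls the metric of `N` back to the metric of `M`. -/
def PreservesMetric (M : HermitianManifold.{u} m) (N : HermitianManifold.{u} n) (F : M → N) :
    Prop :=
  ∀ (p : M) (v w : RealTangent m p),
    N.metric.inner (F p) (differential M N F p v) (differential M N F p w) =
      M.metric.inner p v w

/-- `s` is a symmetry of `M` at `p`: an involutive holomorphic isometry of `M` of which `p` is an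
isolated fixed point. -/
structure IsSymmetryAt (M : HermitianManifold.{u} n) (p : M) (s : Equiv.Perm M) : Prop where
  involutive : Function.Involutive s
  holomorphic : IsHolomorphic M M s
  isometric : PreservesMetric M M s
  fixed : s p = p
  isolated : ∀ᶠ q in 𝓝 p, s q = q → q = p

/-- Hermitian symmetric spaces: connected Hermitian manifolds with a symmetry at each point. -/
structure IsHermitianSymmetric (M : HermitianManifold.{u} n) : Prop where
  connected : ConnectedSpace M
  symmetries : ∀ p : M, ∃ s : Equiv.Perm M, IsSymmetryAt M p s

/-- The group of transvections of a symmetric space, generated by the products of two symmetries.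
It is the identity component of the isometry group when that group is semisimple, and the group of
translations for a flat space. -/
def transvections (M : HermitianManifold.{u} n) : Subgroup (Equiv.Perm M) :=
  Subgroup.closure {φ | ∃ (p q : M) (s t : Equiv.Perm M),
    IsSymmetryAt M p s ∧ IsSymmetryAt M q t ∧ φ = s * t}

/-- A symmetric space `M` is irreducible: it is not a point, and at each point the (real) linear
isotropy representation of its transvection group is irreducible. -/
def IsIrreducible (M : HermitianManifold.{u} n) : Prop :=
  0 < n ∧ ∀ (p : M) (W : Submodule ℝ (Cn n)),
    (∀ φ ∈ transvections M, φ p = p → ∀ v ∈ W, (differential M M φ p v : Cn n) ∈ W) →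
      W = ⊥ ∨ W = ⊤

/-- `M` is `ℂⁿ` with its standard flat Hermitian metric, up to holomorphic isometry. -/
def IsEuclidean (M : HermitianManifold.{u} n) : Prop :=
  ∃ Φ : Cn n ≃ M,
    MDifferentiable 𝓘(ℂ, Cn n) 𝓘(ℂ, Cn n) Φ ∧ MDifferentiable 𝓘(ℂ, Cn n) 𝓘(ℂ, Cn n) Φ.symm ∧
    ∀ z v w : Cn n,
      M.metric.inner (Φ z) (mfderiv 𝓘(ℝ, Cn n) 𝓘(ℝ, Cn n) Φ z v)
        (mfderiv 𝓘(ℝ, Cn n) 𝓘(ℝ, Cn n) Φ z w) = (inner ℂ v w).re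

/-- The spaces `M` and `N` are of the same type (Euclidean, compact or non-compact). -/
def SameType (M : HermitianManifold.{u} m) (N : HermitianManifold.{u} n) : Prop :=
  (IsEuclidean M ↔ IsEuclidean N) ∧ (CompactSpace M ↔ CompactSpace N)

/-- The set `B` is the real form of `M` associated with `σ`: `σ` is an involutive anti-holomorphic
isometry of `M`, and `B` is its fixed point set, which is non-empty. -/
structure IsRealFormOf (M : HermitianManifold.{u} n) (σ : M → M) (B : Set M) : Prop where
  antiholomorphic : IsAntiholomorphic M M σ
  involutive : Function.Involutive σ
  isometric : PreservesMetric M M σ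
  fixedPoints_eq : Function.fixedPoints σ = B
  nonempty : B.Nonempty

/-- `B` is a real form of `M`. -/
def IsRealForm (M : HermitianManifold.{u} n) (B : Set M) : Prop :=
  ∃ σ : M → M, IsRealFormOf M σ B

/-- The metric in the preferred chart at `p₀`, as a function of the chart point `x` and of two
vectors of the model space. -/
noncomputable def chartMetric (M : HermitianManifold.{u} n) (p₀ : M) (x u v : Cn n) : ℝ :=
  M.metric.inner ((extChartAt 𝓘(ℝ, Cn n) p₀).symm x)
    (mfderiv 𝓘(ℝ, Cn n) 𝓘(ℝ, Cn n) (extChartAt 𝓘(ℝ, Cn n) p₀).symm x u)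
    (mfderiv 𝓘(ℝ, Cn n) 𝓘(ℝ, Cn n) (extChartAt 𝓘(ℝ, Cn n) p₀).symm x v)

/-- `γ` is a geodesic on the open set of times `T`: it is smooth there and satisfies the geodesic
equation, written in charts as the Euler-Lagrange equation
`d/dt g_c(c', w) = (1/2) ∂_w g_c(c', c')` of the energy, for each constant vector `w`. -/
def IsGeodesicOn (M : HermitianManifold.{u} n) (γ : ℝ → M) (T : Set ℝ) : Prop :=
  ∀ t ∈ T, ContMDiffAt 𝓘(ℝ, ℝ) 𝓘(ℝ, Cn n) ∞ γ t ∧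
    ∀ (c : ℝ → Cn n), c = extChartAt 𝓘(ℝ, Cn n) (γ t) ∘ γ → ∀ w : Cn n,
      deriv (fun s => chartMetric M (γ t) (c s) (deriv c s) w) t =
        (1 / 2 : ℝ) *
          fderiv ℝ (fun x => chartMetric M (γ t) x (deriv c t) (deriv c t)) (c t) w

/-- `F` realizes `M` as a totally geodesic complex submanifold of `N`, with the induced complex
structure and metric: it is a holomorphic isometric embedding that maps geodesics to geodesics. -/
structure IsTotallyGeodesicEmbedding (M : HermitianManifold.{u} m) (N : HermitianManifold.{u} n)
    (F : M → N) : Prop where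
  holomorphic : IsHolomorphic M N F
  isometric : PreservesMetric M N F
  embedding : Topology.IsEmbedding F
  geodesic : ∀ (γ : ℝ → M) (a b : ℝ),
    IsGeodesicOn M γ (Set.Ioo a b) → IsGeodesicOn N (F ∘ γ) (Set.Ioo a b)

/-- Near its point `q`, the set `H` is a smooth real hypersurface of `M`: the zero set of a smooth
real function without critical points. -/
def IsHypersurfaceAt (M : HermitianManifold.{u} n) (H : Set M) (q : M) : Prop :=
  q ∈ H ∧ ∃ U : Set M, IsOpen U ∧ q ∈ U ∧ ∃ r : M → ℝ,
    ContMDiffOn 𝓘(ℝ, Cn n) 𝓘(ℝ, ℝ) ∞ r U ∧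
    (∀ x ∈ U, mfderiv 𝓘(ℝ, Cn n) 𝓘(ℝ, ℝ) r x ≠ 0) ∧
    H ∩ U = {x ∈ U | r x = 0}

/-- The real form `B` of the Hermitian symmetric space `M` is recursive.

The chain `M₁ ⊂ ⋯ ⊂ Mₙ₋₁ ⊂ M` is given by spaces `N k` with inclusions `ι k : N k → M` and
`j k : N k → N (k + 1)`; only the members with `1 ≤ k < n` are constrained. -/
def IsRecursiveRealForm (M : HermitianManifold.{u} n) (B : Set M) : Prop :=
  (IsEuclidean M ∨ IsIrreducible M) ∧ IsRealForm M B ∧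
  ∃ (N : (k : ℕ) → HermitianManifold.{u} k) (ι : (k : ℕ) → N k → M)
    (j : (k : ℕ) → N k → N (k + 1)),
    (∀ k, 1 ≤ k → k < n →
      IsHermitianSymmetric (N k) ∧ SameType (N k) M ∧
      IsTotallyGeodesicEmbedding (N k) M (ι k) ∧
      IsRealForm (N k) (ι k ⁻¹' B)) ∧
    (∀ k, 1 ≤ k → k + 1 < n →
      ι (k + 1) ∘ j k = ι k ∧
      IsTotallyGeodesicEmbedding (N k) (N (k + 1)) (j k) ∧
      ∃ H : Set (N (k + 1)),
        ι (k + 1) ⁻¹' B ∪ Set.range (j k) ⊆ H ∧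
        ι (k + 1) ⁻¹' B ∪ Set.range (j k) ⊆
          closure {q ∈ ι (k + 1) ⁻¹' B ∪ Set.range (j k) | IsHypersurfaceAt (N (k + 1)) H q})

end HermitianManifold

/-! The function `h = f - conj (f ∘ σ)` is holomorphic, since conjugation and `σ` each reverse `i`,
and it vanishes on `B`, where `σ` is the identity and `f` is real. The claim is `h = 0`. Near a
point of `B` the fixed set of `σ` is, in suitable holomorphic coordinates, a real form of the
complex vector space. These coordinates come from averaging a chart over the group generated by `σ`
(`eventually_eq_zero_of_antiholomorphic_involution`), which makes `σ` antilinear. In the linear case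
every vector is `u + i v` with `u`, `v` fixed, and the one-variable identity theorem on the complex
line `u + ζ v` carries vanishing from real `ζ` to `ζ = i`
(`eventually_eq_zero_of_antilinear_involution`). So `h` vanishes near one point of `B`, and
connectedness of `M` spreads this to all of `M` (`MDifferentiable.eq_zero_of_eventually_eq_zero`).
-/

/-! ### Vanishing on fixed sets of antiholomorphic involutions in a complex normed space. -/

section LocalTheory

variable {E : Type*} [NormedAddCommGroup E] [NormedSpace ℂ E]

/-- A holomorphic function on a convex open set that vanishes at the points `a + t • v`, for all
small real `t`, vanishes at all the points `a + ζ • v` of the set. -/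
theorem eq_zero_of_eventually_eq_zero_on_real_line {U : Set E} (hU : IsOpen U)
    (hUc : Convex ℝ U) {h : E → ℂ} (hd : DifferentiableOn ℂ h U) {a v : E} (ha : a ∈ U)
    (h0 : ∀ᶠ t : ℝ in 𝓝 0, h (a + (t : ℂ) • v) = 0) {ζ : ℂ} (hζ : a + ζ • v ∈ U) :
    h (a + ζ • v) = 0 := by
  let L : ℂ → E := fun ζ => a + ζ • v
  have hLd : Differentiable ℂ L := by fun_prop
  have hV : IsOpen (L ⁻¹' U) := hU.preimage hLd.continuous
  have hVc : Convex ℝ (L ⁻¹' U) := by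
    intro x hx y hy s t hs ht hst
    have := hUc hx hy hs ht hst
    have e : L (s • x + t • y) = s • L x + t • L y := by
      have e1 : a = (s + t) • a := by rw [hst, one_smul]
      simp only [L, smul_add, add_smul, smul_assoc]
      conv_lhs => rw [e1, add_smul]
      abel
    simpa only [Set.mem_preimage, e] using this
  have hdL : DifferentiableOn ℂ (h ∘ L) (L ⁻¹' U) :=
    hd.comp hLd.differentiableOn fun _ hx => hx
  have han := hdL.analyticOnNhd hV
  have h0V : (0 : ℂ) ∈ L ⁻¹' U := by simpa [L] using ha
  -- The nonzero real parameters accumulate at `0`, which is all the one-variable identity theorem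
  -- needs.
  have hfreq : ∃ᶠ z in 𝓝[≠] (0 : ℂ), (h ∘ L) z = 0 := by
    have hto : Filter.Tendsto (fun t : ℝ => (t : ℂ)) (𝓝[≠] 0) (𝓝[≠] 0) := by
      refine tendsto_nhdsWithin_of_tendsto_nhds_of_eventually_within _ ?_ ?_
      · exact (Complex.continuous_ofReal.tendsto' 0 0 (by simp)).mono_left nhdsWithin_le_nhds
      · filter_upwards [self_mem_nhdsWithin] with t ht
        simpa using ht
    exact hto.frequently ((h0.filter_mono nhdsWithin_le_nhds).frequently)
  exact han.eqOn_zero_of_preconnected_of_frequently_eq_zero hVc.isPreconnected h0V hfreq hζ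

/-- The identity theorem on convex open sets. -/
theorem eqOn_zero_of_convex_of_eventuallyEq_zero {U : Set E} (hU : IsOpen U)
    (hUc : Convex ℝ U) {h : E → ℂ} (hd : DifferentiableOn ℂ h U) {a : E} (ha : a ∈ U)
    (h0 : ∀ᶠ x in 𝓝 a, h x = 0) {z : E} (hz : z ∈ U) : h z = 0 := by
  have hc : Filter.Tendsto (fun t : ℝ => a + (t : ℂ) • (z - a)) (𝓝 0) (𝓝 a) :=
    Continuous.tendsto' (by fun_prop) _ _ (by simp)
  have := eq_zero_of_eventually_eq_zero_on_real_line hU hUc hd ha (v := z - a) (ζ := 1)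
    (hc.eventually h0) (by simpa using hz)
  simpa using this

/-- A holomorphic function near `0` that vanishes on the fixed points of an antilinear involution
vanishes near `0`. -/
theorem eventually_eq_zero_of_antilinear_involution {A : E →L[ℝ] E}
    (hA : ∀ v, A (Complex.I • v) = -(Complex.I • A v)) (hAA : ∀ v, A (A v) = v) {h : E → ℂ}
    (hd : ∀ᶠ x in 𝓝 0, DifferentiableAt ℂ h x) (h0 : ∀ᶠ x in 𝓝 0, A x = x → h x = 0) :
    ∀ᶠ x in 𝓝 0, h x = 0 := by
  obtain ⟨r, hr, hball⟩ := Metric.eventually_nhds_iff_ball.1 (hd.and h0)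
  -- `P` and `Q` are the real and imaginary parts for the real structure `A`; both take values in
  -- the fixed space of `A`.
  let P : E →L[ℝ] E := (1 / 2 : ℝ) • (ContinuousLinearMap.id ℝ E + A)
  let Q : E →L[ℝ] E := P.comp ((-Complex.I) • ContinuousLinearMap.id ℝ E)
  have hP : ∀ x, A (P x) = P x := by
    intro x; simp [P, hAA, add_comm]
  have hPQ : ∀ x, P x + Complex.I • Q x = x := by
    intro x
    have e : Q x = (1 / 2 : ℝ) • (-(Complex.I • x) + Complex.I • A x) := by
      simp [Q, P, hA, add_comm]
    rw [e, smul_comm, smul_add, smul_neg, smul_smul, smul_smul, Complex.I_mul_I]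
    simp only [P, smul_apply, add_apply,
      ContinuousLinearMap.id_apply]
    module
  have hPr : ∀ᶠ x in 𝓝 (0 : E), P x ∈ Metric.ball 0 r :=
    (P.continuous.tendsto' 0 0 (map_zero P)).eventually (Metric.ball_mem_nhds 0 hr)
  filter_upwards [hPr, Metric.ball_mem_nhds 0 hr] with x hx hxr
  have hdb : DifferentiableOn ℂ h (Metric.ball 0 r) := fun y hy =>
    (hball y hy).1.differentiableWithinAt
  have hline : Filter.Tendsto (fun t : ℝ => P x + (t : ℂ) • Q x) (𝓝 0) (𝓝 (P x)) :=
    Continuous.tendsto' (by fun_prop) _ _ (by simp)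
  have := eq_zero_of_eventually_eq_zero_on_real_line Metric.isOpen_ball (convex_ball 0 r) hdb hx
    (v := Q x) (ζ := Complex.I)
    (by
      filter_upwards [hline.eventually (Metric.isOpen_ball.mem_nhds hx)] with t ht
      refine (hball _ ht).2 ?_
      have : ((t : ℂ) • Q x) = t • Q x := Complex.coe_smul t (Q x)
      rw [this, map_add, map_smul, hP]
      exact congrArg (fun y => P x + t • y) (hP _))
    (by rw [hPQ]; exact hxr)
  rwa [hPQ] at this

/-- A real differentiable map whose differential commutes with `i` is complex differentiable. -/
theorem differentiableAt_complex_of_map_I_smul {F : Type*} [NormedAddCommGroup F]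
    [NormedSpace ℂ F] {g : E → F} {x : E} (hg : DifferentiableAt ℝ g x)
    (hI : ∀ v, fderiv ℝ g x (Complex.I • v) = Complex.I • fderiv ℝ g x v) :
    DifferentiableAt ℂ g x := by
  rw [differentiableAt_iff_restrictScalars ℝ hg]
  refine ⟨{ toFun := fderiv ℝ g x
            map_add' := map_add _
            map_smul' := fun c v => ?_
            cont := (fderiv ℝ g x).continuous }, rfl⟩
  have e : ∀ w : E, c • w = c.re • w + c.im • (Complex.I • w) := fun w => by
    conv_lhs => rw [← Complex.re_add_im c, add_smul, mul_smul, Complex.coe_smul, Complex.coe_smul]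
  have e' : ∀ w : F, c • w = c.re • w + c.im • (Complex.I • w) := fun w => by
    conv_lhs => rw [← Complex.re_add_im c, add_smul, mul_smul, Complex.coe_smul, Complex.coe_smul]
  simp [e, e', hI]

/-- A holomorphic function near a fixed point of an antiholomorphic involution that vanishes on the
fixed points vanishes near the point. -/
theorem eventually_eq_zero_of_antiholomorphic_involution [CompleteSpace E] {τ : E → E} {x₀ : E}
    (hτ : ContDiffAt ℝ ∞ τ x₀) (hfix : τ x₀ = x₀) (hinv : ∀ᶠ x in 𝓝 x₀, τ (τ x) = x)
    (hanti : ∀ᶠ x in 𝓝 x₀, ∀ v, fderiv ℝ τ x (Complex.I • v) = -(Complex.I • fderiv ℝ τ x v))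
    {h : E → ℂ} (hd : ∀ᶠ x in 𝓝 x₀, DifferentiableAt ℂ h x)
    (h0 : ∀ᶠ x in 𝓝 x₀, τ x = x → h x = 0) : ∀ᶠ x in 𝓝 x₀, h x = 0 := by
  have hne : (∞ : WithTop ℕ∞) ≠ 0 := by simp
  have hdiff : ∀ᶠ x in 𝓝 x₀, DifferentiableAt ℝ τ x := by
    -- The order drops to `1` because `ContDiffAt` spreads to nearby points at finite order, but not
    -- at order `∞`.
    filter_upwards [(hτ.of_le (m := 1) (by simp)).eventually (by simp)] with x hx
    exact hx.differentiableAt (by simp)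
  have hτ0 := hτ.differentiableAt hne
  set A : E →L[ℝ] E := fderiv ℝ τ x₀ with hAdef
  have hAI : ∀ v, A (Complex.I • v) = -(Complex.I • A v) := hanti.self_of_nhds
  have hAA : ∀ v, A (A v) = v := by
    have h1 : HasFDerivAt (τ ∘ τ) (A.comp A) x₀ := by
      refine HasFDerivAt.comp x₀ ?_ hτ0.hasFDerivAt
      rw [hfix]; exact hτ0.hasFDerivAt
    have h2 : HasFDerivAt (τ ∘ τ) (ContinuousLinearMap.id ℝ E) x₀ :=
      (hasFDerivAt_id x₀).congr_of_eventuallyEq hinv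
    intro v
    exact congrArg (fun T : E →L[ℝ] E => T v) (h1.unique h2)
  -- Averaging `x - x₀` over `τ` gives `ψ ∘ τ = A ∘ ψ` near `x₀`. The differential at `x₀` is the
  -- identity, as `A ∘ A = id`, and near `x₀` it is complex linear, as `A ∘ dτ` composes two
  -- antilinear maps.
  let ψ : E → E := fun x => (1 / 2 : ℝ) • ((x - x₀) + A (τ x - x₀))
  have hψc : ContDiffAt ℝ ∞ ψ x₀ :=
    ((contDiffAt_id.sub contDiffAt_const).add
      (A.contDiff.contDiffAt.comp x₀ (hτ.sub contDiffAt_const))).const_smul _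
  have hψd : ∀ x, DifferentiableAt ℝ τ x →
      HasFDerivAt ψ ((1 / 2 : ℝ) • (ContinuousLinearMap.id ℝ E + A.comp (fderiv ℝ τ x))) x :=
    fun x hx => (((hasFDerivAt_id x).sub_const x₀).add
      (A.hasFDerivAt.comp x (hx.hasFDerivAt.sub_const x₀))).const_smul _
  have hψ0 : HasFDerivAt ψ ((ContinuousLinearEquiv.refl ℝ E : E ≃L[ℝ] E) : E →L[ℝ] E) x₀ := by
    convert hψd x₀ hτ0 using 1
    ext v
    simp only [ContinuousLinearEquiv.coe_refl, ContinuousLinearMap.id_apply,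
      smul_apply, add_apply,
      ContinuousLinearMap.comp_apply, ← hAdef, hAA]
    module
  have hψx : ψ x₀ = 0 := by simp [ψ, hfix]
  let e := hψc.toOpenPartialHomeomorph ψ hψ0 hne
  have he : ∀ x, e x = ψ x := fun x => rfl
  have hx₀ : x₀ ∈ e.source := hψc.mem_toOpenPartialHomeomorph_source hψ0 hne
  let χ : E → E := e.symm
  have h0t : (0 : E) ∈ e.target := by
    have := e.map_source hx₀; rwa [he, hψx] at this
  have hχ0 : χ 0 = x₀ := by
    have := e.left_inv hx₀; rwa [he, hψx] at this
  have hχc : ContDiffAt ℝ ∞ χ 0 := by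
    have := hψc.to_localInverse hψ0 hne
    rw [hψx] at this
    exact this
  have hχd : ∀ᶠ y in 𝓝 (0 : E), DifferentiableAt ℝ χ y := by
    filter_upwards [(hχc.of_le (m := 1) (by simp)).eventually (by simp)] with y hy
    exact hy.differentiableAt (by simp)
  have hχt : Filter.Tendsto χ (𝓝 0) (𝓝 x₀) := by
    have := hχc.continuousAt.tendsto; rwa [hχ0] at this
  have hψχ : ∀ᶠ y in 𝓝 (0 : E), ψ (χ y) = y := by
    filter_upwards [e.open_target.mem_nhds h0t] with y hy
    exact e.right_inv hy
  have hχI : ∀ᶠ y in 𝓝 (0 : E), DifferentiableAt ℂ χ y := by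
    filter_upwards [hχd, hψχ.eventually_nhds, hχt.eventually hdiff, hχt.eventually hanti,
      hχt.eventually (e.open_source.mem_nhds hx₀)] with y hy hyi hyd hya hys
    refine differentiableAt_complex_of_map_I_smul hy fun v => ?_
    set D := (1 / 2 : ℝ) • (ContinuousLinearMap.id ℝ E + A.comp (fderiv ℝ τ (χ y))) with hD
    have hDI : ∀ w, D (Complex.I • w) = Complex.I • D w := by
      intro w
      simp only [hD, smul_apply, add_apply,
        ContinuousLinearMap.id_apply, ContinuousLinearMap.comp_apply, hya, map_neg, hAI, neg_neg]
      rw [smul_comm Complex.I, smul_add, smul_add, smul_add]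
    have hcomp : D.comp (fderiv ℝ χ y) = ContinuousLinearMap.id ℝ E :=
      ((hψd _ hyd).comp y hy.hasFDerivAt).unique ((hasFDerivAt_id y).congr_of_eventuallyEq hyi)
    have hDχ : ∀ w, D (fderiv ℝ χ y w) = w := fun w =>
      congrArg (fun T : E →L[ℝ] E => T w) hcomp
    -- With both compositions known, `dχ` is the two-sided inverse of the complex linear `D`, hence
    -- complex linear.
    have hχD : ∀ w, fderiv ℝ χ y (D w) = w := by
      have hleft : ∀ᶠ x in 𝓝 (χ y), χ (ψ x) = x := by
        filter_upwards [e.open_source.mem_nhds hys] with x hx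
        exact e.left_inv hx
      have hcomp' : (fderiv ℝ χ y).comp D = ContinuousLinearMap.id ℝ E := by
        refine (HasFDerivAt.comp (χ y) (g := χ) ?_ (hψd _ hyd)).unique
          ((hasFDerivAt_id (χ y)).congr_of_eventuallyEq hleft)
        rw [hyi.self_of_nhds]
        exact hy.hasFDerivAt
      exact fun w => congrArg (fun T : E →L[ℝ] E => T w) hcomp'
    calc fderiv ℝ χ y (Complex.I • v)
        = fderiv ℝ χ y (D (Complex.I • fderiv ℝ χ y v)) := by rw [hDI, hDχ]
      _ = Complex.I • fderiv ℝ χ y v := hχD _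
  have hA0 : Filter.Tendsto A (𝓝 0) (𝓝 0) := A.continuous.tendsto' 0 0 (map_zero A)
  have hτt : Filter.Tendsto τ (𝓝 x₀) (𝓝 x₀) := by
    have := hτ.continuousAt.tendsto; rwa [hfix] at this
  have hfixed : ∀ᶠ y in 𝓝 (0 : E), A y = y → τ (χ y) = χ y := by
    filter_upwards [hψχ, hχt.eventually hinv,
      (hτt.comp hχt).eventually (e.open_source.mem_nhds hx₀)] with y hy hyi hys hAy
    have h1 : ψ (τ (χ y)) = A (ψ (χ y)) := by
      simp only [ψ, hyi, map_smul, map_add, hAA]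
      rw [add_comm]
    rw [hy, hAy] at h1
    have h2 : χ (ψ (τ (χ y))) = τ (χ y) := e.left_inv hys
    rw [← h2, h1]
  have hk := eventually_eq_zero_of_antilinear_involution hAI hAA (h := h ∘ χ)
    (by
      filter_upwards [hχI, hχt.eventually hd] with y hy hyd
      exact hyd.comp y hy)
    (by
      filter_upwards [hfixed, hχt.eventually h0] with y hy hyd hAy
      exact hyd (hy hAy))
  have hψt : Filter.Tendsto ψ (𝓝 x₀) (𝓝 0) := by
    have := hψc.continuousAt.tendsto; rwa [hψx] at this
  filter_upwards [hψt.eventually hk, e.open_source.mem_nhds hx₀] with x hx hxs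
  have h2 : χ (ψ x) = x := e.left_inv hxs
  simpa [h2] using hx

end LocalTheory

/-! ### Real and complex differentials, and the identity theorem on complex manifolds. -/

section ComplexManifolds

variable {E F : Type*} [NormedAddCommGroup E] [NormedSpace ℂ E]
  [NormedAddCommGroup F] [NormedSpace ℂ F]
  {M N : Type*} [TopologicalSpace M] [ChartedSpace E M] [TopologicalSpace N] [ChartedSpace F N]

variable (E F) in
/-- The real differential of a map between complex manifolds, as a map of model spaces. -/
noncomputable def realMFDeriv (f : M → N) (x : M) : E →L[ℝ] F :=
  mfderiv 𝓘(ℝ, E) 𝓘(ℝ, F) f x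

/-- A complex differential is also a real differential. -/
theorem HasMFDerivAt.real_of_complex {f : M → N} {x : M} {f' : E →L[ℂ] F}
    (h : HasMFDerivAt 𝓘(ℂ, E) 𝓘(ℂ, F) f x f') :
    HasMFDerivAt 𝓘(ℝ, E) 𝓘(ℝ, F) f x (f'.restrictScalars ℝ) :=
  ⟨h.1, HasFDerivWithinAt.restrictScalars ℝ h.2⟩

theorem MDifferentiableAt.real_of_complex {f : M → N} {x : M}
    (h : MDifferentiableAt 𝓘(ℂ, E) 𝓘(ℂ, F) f x) : MDifferentiableAt 𝓘(ℝ, E) 𝓘(ℝ, F) f x :=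
  (HasMFDerivAt.real_of_complex h.hasMFDerivAt).mdifferentiableAt

/-- The real differential of a holomorphic map commutes with `i`. -/
theorem MDifferentiableAt.mfderiv_I_smul {f : M → N} {x : M}
    (h : MDifferentiableAt 𝓘(ℂ, E) 𝓘(ℂ, F) f x) (v : E) :
    (realMFDeriv E F f x) (Complex.I • v) =
      Complex.I • (realMFDeriv E F f x) v := by
  rw [realMFDeriv, (HasMFDerivAt.real_of_complex h.hasMFDerivAt).mfderiv]
  exact (mfderiv 𝓘(ℂ, E) 𝓘(ℂ, F) f x : E →L[ℂ] F).map_smul _ _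

/-- A real differentiable map whose differential commutes with `i` is holomorphic. -/
theorem mdifferentiableAt_complex_of_mfderiv_I_smul {f : M → N} {x : M}
    (h : MDifferentiableAt 𝓘(ℝ, E) 𝓘(ℝ, F) f x)
    (hI : ∀ v : E, (realMFDeriv E F f x) (Complex.I • v) =
      Complex.I • (realMFDeriv E F f x) v) :
    MDifferentiableAt 𝓘(ℂ, E) 𝓘(ℂ, F) f x := by
  rw [mdifferentiableAt_iff]
  refine ⟨h.continuousAt, ?_⟩
  have hd : DifferentiableWithinAt ℝ (writtenInExtChartAt 𝓘(ℝ, E) 𝓘(ℝ, F) x f)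
    (Set.range 𝓘(ℝ, E)) (extChartAt 𝓘(ℝ, E) x x) := ((mdifferentiableAt_iff _ _).1 h).2
  have hm : mfderiv 𝓘(ℝ, E) 𝓘(ℝ, F) f x =
      fderivWithin ℝ (writtenInExtChartAt 𝓘(ℝ, E) 𝓘(ℝ, F) x f)
        (Set.range 𝓘(ℝ, E)) (extChartAt 𝓘(ℝ, E) x x) := h.mfderiv
  rw [realMFDeriv, hm] at hI
  have hr : Set.range 𝓘(ℝ, E) = Set.univ := by simp
  have hr' : Set.range 𝓘(ℂ, E) = Set.univ := by simp
  rw [hr, fderivWithin_univ] at hI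
  rw [hr, differentiableWithinAt_univ] at hd
  rw [hr', differentiableWithinAt_univ]
  exact differentiableAt_complex_of_map_I_smul hd hI

variable [IsManifold 𝓘(ℂ, E) 1 M]

/-- A holomorphic function read in a chart is complex differentiable. -/
theorem MDifferentiable.differentiableOn_comp_extChartAt_symm {h : M → ℂ}
    (hh : MDifferentiable 𝓘(ℂ, E) 𝓘(ℂ, ℂ) h) (p : M) :
    DifferentiableOn ℂ (h ∘ (extChartAt 𝓘(ℂ, E) p).symm) (extChartAt 𝓘(ℂ, E) p).target := by
  rw [← mdifferentiableOn_iff_differentiableOn]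
  exact hh.comp_mdifferentiableOn
    ((contMDiffOn_extChartAt_symm (n := 1) p).mdifferentiableOn (by simp))

/-- The identity theorem for holomorphic functions on connected complex manifolds. -/
theorem MDifferentiable.eq_zero_of_eventually_eq_zero [PreconnectedSpace M] {h : M → ℂ}
    (hh : MDifferentiable 𝓘(ℂ, E) 𝓘(ℂ, ℂ) h) {p : M} (hp : ∀ᶠ q in 𝓝 p, h q = 0) (q : M) :
    h q = 0 := by
  let S : Set M := {q | ∀ᶠ x in 𝓝 q, h x = 0}
  have hSo : IsOpen S := isOpen_iff_mem_nhds.2 fun q hq => hq.eventually_nhds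
  have hSc : IsClosed S := by
    refine isClosed_of_closure_subset fun q hq => ?_
    set c := extChartAt 𝓘(ℂ, E) q with hc
    obtain ⟨r, hr, hball⟩ := Metric.mem_nhds_iff.1 (extChartAt_target_mem_nhds (I := 𝓘(ℂ, E)) q)
    have hn : c.source ∩ c ⁻¹' Metric.ball (c q) r ∈ 𝓝 q :=
      Filter.inter_mem (extChartAt_source_mem_nhds q)
        ((continuousAt_extChartAt q).preimage_mem_nhds (Metric.ball_mem_nhds _ hr))
    -- A chart ball about the limit point `q` contains a point `s` of `S`; convexity of the ball
    -- carries the vanishing from `s` to the whole ball.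
    obtain ⟨s, ⟨hsc, hsb⟩, hsS⟩ := mem_closure_iff_nhds.1 hq _ hn
    have hs0 : ∀ᶠ x in 𝓝 (c s), (h ∘ c.symm) x = 0 := by
      have ht : Filter.Tendsto c.symm (𝓝 (c s)) (𝓝 s) := by
        have := (continuousAt_extChartAt_symm'' (I := 𝓘(ℂ, E)) (c.map_source hsc)).tendsto
        rwa [← hc, c.left_inv hsc] at this
      exact ht.eventually hsS
    filter_upwards [hn] with x hx
    have := eqOn_zero_of_convex_of_eventuallyEq_zero Metric.isOpen_ball (convex_ball (c q) r)
      ((hh.differentiableOn_comp_extChartAt_symm q).mono hball) hsb hs0 hx.2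
    rwa [Function.comp_apply, c.left_inv hx.1] at this
  have : S = Set.univ := IsClopen.eq_univ ⟨hSc, hSo⟩ ⟨p, hp⟩
  have hq : q ∈ S := this ▸ Set.mem_univ q
  exact hq.self_of_nhds

end ComplexManifolds

/-! ### Antiholomorphic maps on Hermitian manifolds. -/

namespace HermitianManifold

variable {n : ℕ} {M : HermitianManifold.{u} n}

/-- The differential of an antiholomorphic map anticommutes with `i`. -/
theorem IsAntiholomorphic.mfderiv_I_smul {σ : M → M} (hσ : IsAntiholomorphic M M σ) (p : M)
    (v : Cn n) :
    (realMFDeriv (Cn n) (Cn n) σ p) (Complex.I • v) =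
      -(Complex.I • (realMFDeriv (Cn n) (Cn n) σ p) v) :=
  hσ.2 p v

/-- The conjugate of the composition of a holomorphic function with an antiholomorphic map is
holomorphic. -/
theorem IsAntiholomorphic.mdifferentiable_conj_comp {σ : M → M} (hσ : IsAntiholomorphic M M σ)
    {f : M → ℂ} (hf : MDifferentiable 𝓘(ℂ, Cn n) 𝓘(ℂ, ℂ) f) :
    MDifferentiable 𝓘(ℂ, Cn n) 𝓘(ℂ, ℂ) (fun p => conj (f (σ p))) := by
  intro p
  have hσp := (hσ.1.mdifferentiable (by simp) p).hasMFDerivAt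
  have hfp := (MDifferentiableAt.real_of_complex (hf (σ p))).hasMFDerivAt
  have hcp : HasMFDerivAt 𝓘(ℝ, ℂ) 𝓘(ℝ, ℂ) (fun z : ℂ => conj z) (f (σ p))
      (Complex.conjCLE : ℂ →L[ℝ] ℂ) :=
    (Complex.conjCLE : ℂ →L[ℝ] ℂ).hasFDerivAt.hasMFDerivAt
  have hcomp := HasMFDerivAt.comp p hcp (HasMFDerivAt.comp p hfp hσp)
  refine mdifferentiableAt_complex_of_mfderiv_I_smul hcomp.mdifferentiableAt fun v => ?_
  rw [realMFDeriv, show (fun p => conj (f (σ p))) = (fun z : ℂ => conj z) ∘ (f ∘ σ) from rfl,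
    hcomp.mfderiv]
  change conj ((realMFDeriv (Cn n) ℂ f (σ p))
    ((realMFDeriv (Cn n) (Cn n) σ p) (Complex.I • v))) =
    Complex.I • conj ((realMFDeriv (Cn n) ℂ f (σ p))
    ((realMFDeriv (Cn n) (Cn n) σ p) v))
  rw [hσ.mfderiv_I_smul, map_neg, (hf (σ p)).mfderiv_I_smul]
  simp

/-- A holomorphic function that vanishes on the fixed points of an antiholomorphic involution
vanishes near each of them. -/
theorem IsAntiholomorphic.eventually_eq_zero {σ : M → M} (hσ : IsAntiholomorphic M M σ)
    (hinv : Function.Involutive σ) {h : M → ℂ} (hh : MDifferentiable 𝓘(ℂ, Cn n) 𝓘(ℂ, ℂ) h)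
    (h0 : ∀ q, σ q = q → h q = 0) {p : M} (hp : σ p = p) : ∀ᶠ q in 𝓝 p, h q = 0 := by
  let c := extChartAt 𝓘(ℝ, Cn n) p
  let τ : Cn n → Cn n := c ∘ σ ∘ c.symm
  have hτ : ContDiffAt ℝ ∞ τ (c p) := by
    have := (contMDiffAt_iff.1 (hσ.1 p)).2
    rw [hp] at this
    rw [modelWithCornersSelf_coe, Set.range_id] at this
    exact this
  have hsymm : c.symm (c p) = p := extChartAt_to_inv p
  have hfix : τ (c p) = c p := by simp only [τ, Function.comp_apply, hsymm, hp]
  have hct : Filter.Tendsto c.symm (𝓝 (c p)) (𝓝 p) := by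
    have := (continuousAt_extChartAt_symm (I := 𝓘(ℝ, Cn n)) p).tendsto
    rwa [extChartAt_to_inv] at this
  have hσt : Filter.Tendsto σ (𝓝 p) (𝓝 p) := by
    have := hσ.1.continuous.tendsto p; rwa [hp] at this
  have hsrc : ∀ᶠ x in 𝓝 (c p), σ (c.symm x) ∈ c.source :=
    (hσt.comp hct).eventually (extChartAt_source_mem_nhds p)
  have htgt : ∀ᶠ x in 𝓝 (c p), x ∈ c.target := extChartAt_target_mem_nhds p
  have hloc := eventually_eq_zero_of_antiholomorphic_involution (h := h ∘ c.symm) hτ hfix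
    (by
      filter_upwards [hsrc, htgt] with x hx hxt
      simp only [τ, Function.comp_apply]
      rw [c.left_inv hx, hinv, c.right_inv hxt])
    (by
      filter_upwards [hsrc, htgt] with x hx hxt v
      have : IsManifold 𝓘(ℂ, Cn n) 1 M := IsManifold.of_le (n := ω) le_top
      -- The real and complex extended charts are the same map, so `c` and its inverse are
      -- holomorphic and `τ` inherits antilinearity from `σ` by the chain rule.
      have hcs : MDifferentiableAt 𝓘(ℂ, Cn n) 𝓘(ℂ, Cn n) c.symm x :=
        ((contMDiffOn_extChartAt_symm (I := 𝓘(ℂ, Cn n)) (n := 1) p).mdifferentiableOn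
          (by simp)).mdifferentiableAt
          ((isOpen_extChartAt_target (I := 𝓘(ℂ, Cn n)) p).mem_nhds hxt)
      have hcσ : MDifferentiableAt 𝓘(ℂ, Cn n) 𝓘(ℂ, Cn n) c (σ (c.symm x)) :=
        mdifferentiableAt_extChartAt (I := 𝓘(ℂ, Cn n))
          (by rw [← extChartAt_source 𝓘(ℝ, Cn n)]; exact hx)
      have hcomp := HasMFDerivAt.comp x (MDifferentiableAt.real_of_complex hcσ).hasMFDerivAt
        (HasMFDerivAt.comp x (hσ.1.mdifferentiable (by simp) _).hasMFDerivAt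
          (MDifferentiableAt.real_of_complex hcs).hasMFDerivAt)
      have hτd : HasFDerivAt τ ((realMFDeriv (Cn n) (Cn n) c (σ (c.symm x))).comp
          ((realMFDeriv (Cn n) (Cn n) σ (c.symm x)).comp
            (realMFDeriv (Cn n) (Cn n) c.symm x))) x :=
        hasMFDerivAt_iff_hasFDerivAt.1 hcomp
      rw [hτd.fderiv]
      simp only [ContinuousLinearMap.comp_apply]
      rw [hcs.mfderiv_I_smul, hσ.mfderiv_I_smul, map_neg, hcσ.mfderiv_I_smul])
    (by
      filter_upwards [htgt] with x hxt
      have : IsManifold 𝓘(ℂ, Cn n) 1 M := IsManifold.of_le (n := ω) le_top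
      exact (hh.differentiableOn_comp_extChartAt_symm p).differentiableAt
        ((isOpen_extChartAt_target (I := 𝓘(ℂ, Cn n)) p).mem_nhds hxt))
    (by
      filter_upwards [hsrc, htgt] with x hx hxt hτx
      refine h0 _ ?_
      rw [← c.left_inv hx]
      exact congrArg c.symm hτx)
  filter_upwards [(continuousAt_extChartAt (I := 𝓘(ℝ, Cn n)) p).eventually hloc,
    extChartAt_source_mem_nhds (I := 𝓘(ℝ, Cn n)) p] with q hq hqs
  change h (c.symm (c q)) = 0 at hq
  rwa [c.left_inv hqs] at hq

end HermitianManifold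

/-! ### The reflection identity. -/

theorem corollary6p3 (n : ℕ) (M : HermitianManifold.{u} n)
    (hM : HermitianManifold.IsHermitianSymmetric M)
    (B : Set M) (σ : M → M) (hσ : HermitianManifold.IsRealFormOf M σ B)
    (hB : HermitianManifold.IsRecursiveRealForm M B)
    (f : M → ℂ) (hf : MDifferentiable 𝓘(ℂ, Cn n) 𝓘(ℂ, ℂ) f)
    (hreal : ∀ p ∈ B, (f p).im = 0) :
    ∀ p : M, f (σ p) = conj (f p) := by
  intro p
  have := hM.connected
  have : IsManifold 𝓘(ℂ, Cn n) 1 M := IsManifold.of_le (n := ω) le_top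
  obtain ⟨b, hb⟩ := hσ.nonempty
  have hfix : ∀ q, σ q = q ↔ q ∈ B := fun q => by rw [← hσ.fixedPoints_eq]; rfl
  have hh : MDifferentiable 𝓘(ℂ, Cn n) 𝓘(ℂ, ℂ) (fun q => f q - conj (f (σ q))) :=
    hf.sub (hσ.antiholomorphic.mdifferentiable_conj_comp hf)
  have hloc := hσ.antiholomorphic.eventually_eq_zero hσ.involutive hh
    (fun q hq => by
      rw [hq, Complex.conj_eq_iff_im.2 (hreal q ((hfix q).1 hq)), sub_self]) ((hfix b).2 hb)
  have := sub_eq_zero.1 (hh.eq_zero_of_eventually_eq_zero hloc p)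
  rw [this, Complex.conj_conj]
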